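/- Let $n\ge 1$ and let $m_1\le\cdots\le m_n$ and $m'_1\le\cdots\le m'_n$ be positive integers. Consider the linear actions of $S^1=\{\lambda\in\mathbb C:|\lambda|=1\}$ on $\mathbb C^n$ given by $\rho(\lambda)(z)=(\lambda^{m_1}z_1,\ldots,\lambda^{m_n}z_n)$ and $\rho'(\lambda)(w)=(\lambda^{m'_1}w_1,\ldots,\lambda^{m'_n}w_n)$. Let $D$ and $D'$ be bounded domains (bounded connected open sets) in $\mathbb C^n$ containing the origin, with $\rho(\lambda)(D)\subseteq D$ and $\rho'(\lambda)(D')\subseteq D'$ for all $\lambda\in S^1$ (that is, $D$ and $D'$ are quasi-circular with weights $(m_i)$ and $(m'_i)$). If $f=(f_1,\ldots,f_n):D\to D'$ is a biholomorphism with $f(0)=0$, then $f$ is a polynomial map of degree at most $\frac{m_nm'_n}{m_1m'_1}$; that is, each $f_i$ is the restriction to $D$ of a polynomial in $z_1,\ldots,z_n$ of total degree at most $\frac{m_nm'_n}{m_1m'_1}$. -/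

import Mathlib

/-- The linear action of the circle group `S¹` on `ℂⁿ` with weights `m₁, …, mₙ`:
`ρ(t)(z) = (t ^ m₁ * z₁, …, t ^ mₙ * zₙ)`. -/
noncomputable def weightedCircleAction {n : ℕ} (m : Fin n → ℕ) (t : Circle)
    (z : Fin n → ℂ) : Fin n → ℂ :=
  fun i => (t : ℂ) ^ m i * z i

/-- `D ⊆ ℂⁿ` is a bounded quasi-circular domain containing the origin, with respect to the circle
action with weights `m`: a bounded, open, connected set containing `0` and invariant under the
action. Openness, boundedness and holomorphy on `ℂⁿ` do not depend on the choice of the norm, so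
`ℂⁿ` is modelled by `Fin n → ℂ`. -/
structure IsBoundedQuasiCircularDomain {n : ℕ} (m : Fin n → ℕ) (D : Set (Fin n → ℂ)) : Prop where
  isOpen : IsOpen D
  isConnected : IsConnected D
  isBounded : Bornology.IsBounded D
  zero_mem : (0 : Fin n → ℂ) ∈ D
  invariant : ∀ t : Circle, ∀ z ∈ D, weightedCircleAction m t z ∈ D

/-- `f` restricts to a biholomorphism from `D` onto `D'`: it is holomorphic on `D`, maps `D` into
`D'`, and has a holomorphic two-sided inverse `D' → D`. The values of `f` off `D` play no role. -/
def IsBiholomorphismOn {n : ℕ} (f : (Fin n → ℂ) → (Fin n → ℂ)) (D D' : Set (Fin n → ℂ)) : Prop :=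
  DifferentiableOn ℂ f D ∧ Set.MapsTo f D D' ∧
    ∃ g : (Fin n → ℂ) → (Fin n → ℂ),
      DifferentiableOn ℂ g D' ∧ Set.MapsTo g D' D ∧ Set.InvOn g f D D'

/-! The twisted pull-back `T h = (h ∘ f) · J_f`, with `J_f` the complex Jacobian determinant,
preserves the `L²` pairing of holomorphic functions on D' and D; its inverse is the twisted
pull-back by `g = f⁻¹`. The circle actions preserve volume, so functions of different weights
(`h(t·z) = t^k h(z)`) are orthogonal.

A holomorphic function of weight k vanishes if k < 0. If k ≥ 0, it is a polynomial of degree at most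
k/m_1, by induction through Euler's identity (`HasWeightOn.exists_mvPolynomial`), and it is
O(‖z‖^(k/m_n)) at 0 (`HasWeightOn.exists_norm_pow_le`).

Let h be bounded of weight j on D', and let u be the weight-k component of T h. Then ‖u‖² = ⟨T h, u⟩
= ⟨h, T⁻¹u⟩, and only the weight-j component of T⁻¹u contributes. As g(0) = 0, T⁻¹u is
O(‖w‖^(k/m_n)), which kills that component once j·m_n < m'_1·k
(`weightComponent_comp_mul_jacobianDet_eq_zero`). Hence T h has finitely many components and is a
polynomial of degree at most j·m_n/(m_1 m'_1).

Taking h = 1 (weight 0) makes `J_f` a nonzero constant; taking h = w_i (weight m'_i) then makes f_i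
a polynomial of the required degree. -/

open MeasureTheory Filter Topology Metric Set
open scoped ComplexConjugate

/-! ### Holomorphic functions of several variables. -/

/-- Cauchy's estimate for the Fréchet derivative. -/
theorem norm_fderiv_le_of_forall_closedBall {E : Type*} [NormedAddCommGroup E] [NormedSpace ℂ E]
    {h : E → ℂ} {U : Set E} (hU : IsOpen U) (hd : DifferentiableOn ℂ h U) {z : E} {r M : ℝ}
    (hr : 0 < r) (hz : closedBall z r ⊆ U) (hM : ∀ w ∈ closedBall z r, ‖h w‖ ≤ M) :
    ‖fderiv ℂ h z‖ ≤ M / r := by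
  have hM0 : 0 ≤ M := (norm_nonneg _).trans (hM z (mem_closedBall_self hr.le))
  refine ContinuousLinearMap.opNorm_le_bound _ (by positivity) fun v => ?_
  rcases eq_or_ne v 0 with rfl | hv
  · simp
  have hv' : 0 < ‖v‖ := norm_pos_iff.2 hv
  -- Restriction to the complex line through z in direction v reduces the claim to the one-variable
  -- estimate on the disc of radius r / ‖v‖.
  have hline : ∀ ζ : ℂ, HasFDerivAt (fun ζ : ℂ => z + ζ • v)
      ((ContinuousLinearMap.id ℂ ℂ).smulRight v) ζ := fun ζ =>
    ((hasFDerivAt_id (𝕜 := ℂ) ζ).smul_const v).const_add z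
  have hmem : ∀ ζ ∈ closedBall (0 : ℂ) (r / ‖v‖), z + ζ • v ∈ closedBall z r := by
    intro ζ hζ
    rw [mem_closedBall_zero_iff, le_div_iff₀ hv'] at hζ
    simpa [mem_closedBall, dist_eq_norm, norm_smul] using hζ
  have hdiff : DifferentiableOn ℂ (fun ζ : ℂ => h (z + ζ • v)) (closedBall 0 (r / ‖v‖)) := by
    intro ζ hζ
    have h1 := (hd _ (hz (hmem ζ hζ))).differentiableAt (hU.mem_nhds (hz (hmem ζ hζ)))
    exact (h1.comp ζ (hline ζ).differentiableAt).differentiableWithinAt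
  have hder : deriv (fun ζ : ℂ => h (z + ζ • v)) 0 = fderiv ℂ h z v := by
    have h1 := ((hd z (hz (mem_closedBall_self hr.le))).differentiableAt
      (hU.mem_nhds (hz (mem_closedBall_self hr.le)))).hasFDerivAt
    have h2 : HasFDerivAt h (fderiv ℂ h z) (z + (0 : ℂ) • v) := by simpa using h1
    simpa [Function.comp_def] using (h2.comp (0 : ℂ) (hline 0)).hasDerivAt.deriv
  have hdc : DiffContOnCl ℂ (fun ζ : ℂ => h (z + ζ • v)) (ball 0 (r / ‖v‖)) := by
    apply DifferentiableOn.diffContOnCl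
    rwa [closure_ball _ (by positivity)]
  have := Complex.norm_deriv_le_of_forall_mem_sphere_norm_le (div_pos hr hv') hdc
    (fun ζ hζ => hM _ (hmem ζ (sphere_subset_closedBall hζ)))
  rw [hder] at this
  calc _ ≤ _ := this
    _ = _ := by field_simp

/-- Integrals depending continuously and holomorphically on a parameter are holomorphic. -/
theorem differentiableOn_setIntegral_of_isCompact {n : ℕ} {X : Type*} [TopologicalSpace X]
    [MeasurableSpace X] [OpensMeasurableSpace X] {μ : Measure X} {K : Set X} (hK : IsCompact K)
    (hKm : MeasurableSet K) (hμ : μ K ≠ ⊤) {U : Set (Fin n → ℂ)} (hU : IsOpen U)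
    {F : (Fin n → ℂ) → X → ℂ} (hF : ContinuousOn (Function.uncurry F) (U ×ˢ K))
    (hd : ∀ x ∈ K, DifferentiableOn ℂ (F · x) U) :
    DifferentiableOn ℂ (fun z => ∫ x in K, F z x ∂μ) U := by
  intro z₀ hz₀
  obtain ⟨r, hr, hrU⟩ : ∃ r > 0, closedBall z₀ (2 * r) ⊆ U := by
    obtain ⟨s, hs, hsU⟩ := Metric.nhds_basis_closedBall.mem_iff.1 (hU.mem_nhds hz₀)
    exact ⟨s / 2, by positivity, by simpa [mul_div_cancel₀] using hsU⟩
  obtain ⟨M, hM⟩ := ((isCompact_closedBall z₀ (2 * r)).prod hK).exists_bound_of_continuousOn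
    (hF.mono (prod_mono hrU le_rfl))
  have hFc : ∀ z ∈ U, ContinuousOn (F z) K := fun z hz =>
    hF.comp (f := fun x => (z, x)) (by fun_prop) fun x hx => ⟨hz, hx⟩
  have hFm : ∀ z ∈ U, AEStronglyMeasurable (F z) (μ.restrict K) := fun z hz =>
    (hFc z hz).aestronglyMeasurable hKm
  have : IsFiniteMeasure (μ.restrict K) := ⟨by simpa using hμ.lt_top⟩
  have hsub : ∀ z ∈ ball z₀ r, closedBall z r ⊆ closedBall z₀ (2 * r) := fun z hz =>
    closedBall_subset_closedBall' (by linarith [mem_ball.1 hz])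
  have hdA : ∀ x ∈ K, ∀ z ∈ U, DifferentiableAt ℂ (F · x) z := fun x hx z hz =>
    (hd x hx z hz).differentiableAt (hU.mem_nhds hz)
  -- Each directional derivative is a pointwise limit of difference quotients, hence measurable in
  -- x; the steps `c k` are scaled to keep `z₀ + c k • v` inside U.
  have hmeas : AEStronglyMeasurable (fun x => fderiv ℂ (F · x) z₀) (μ.restrict K) := by
    have hcoord : ∀ v : Fin n → ℂ,
        AEStronglyMeasurable (fun x => fderiv ℂ (F · x) z₀ v) (μ.restrict K) := by
      intro v
      set c : ℕ → ℂ := fun k => (r / (‖v‖ + 1) : ℝ) / ((k : ℂ) + 1) with hc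
      have hcn : ∀ k, ‖c k‖ * ‖v‖ ≤ 2 * r := by
        intro k
        have h1 : ‖c k‖ = r / (‖v‖ + 1) / (k + 1) := by
          rw [hc]
          simp only [norm_div]
          congr 1
          · rw [Complex.norm_real, Real.norm_of_nonneg (by positivity)]
          · norm_cast
        rw [h1, div_div, div_mul_eq_mul_div, div_le_iff₀ (by positivity)]
        have : ‖v‖ ≤ (‖v‖ + 1) * (k + 1) := by
          nlinarith [norm_nonneg v, Nat.cast_nonneg (α := ℝ) k,
            mul_nonneg (norm_nonneg v) (Nat.cast_nonneg (α := ℝ) k)]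
        nlinarith [norm_nonneg v]
      have hc0 : ∀ k, c k ≠ 0 := fun k => by
        rw [hc]
        have h1 : (r / (‖v‖ + 1) : ℝ) ≠ 0 := by positivity
        have h2 : (k : ℂ) + 1 ≠ 0 := by exact_mod_cast k.succ_ne_zero
        exact div_ne_zero (by exact_mod_cast h1) h2
      have hct : Tendsto c atTop (𝓝[≠] 0) := by
        refine tendsto_nhdsWithin_iff.2 ⟨?_, Eventually.of_forall hc0⟩
        have h1 := (tendsto_one_div_add_atTop_nhds_zero_nat (𝕜 := ℂ)).const_mul
          ((r / (‖v‖ + 1) : ℝ) : ℂ)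
        simpa [hc, div_eq_mul_inv] using h1
      have hmem : ∀ k, z₀ + c k • v ∈ U := fun k => hrU (by
        simpa [mem_closedBall, dist_eq_norm, norm_smul] using hcn k)
      refine aestronglyMeasurable_of_tendsto_ae (u := atTop)
        (f := fun k x => (c k)⁻¹ • (F (z₀ + c k • v) x - F z₀ x))
        (fun k => ((hFm _ (hmem k)).sub (hFm _ hz₀)).const_smul (c k)⁻¹) ?_
      filter_upwards [ae_restrict_mem hKm] with x hx
      have h1 : HasLineDerivAt ℂ (F · x) (fderiv ℂ (F · x) z₀ v) z₀ v :=
        (hdA x hx z₀ hz₀).hasFDerivAt.hasLineDerivAt v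
      have h2 := hasDerivAt_iff_tendsto_slope_zero.1 h1
      simpa [Function.comp_def] using h2.comp hct
    have heq : (fun x => fderiv ℂ (F · x) z₀) = fun x => ∑ i : Fin n,
        (fderiv ℂ (F · x) z₀ (Pi.single i 1)) •
          (ContinuousLinearMap.proj (R := ℂ) (φ := fun _ : Fin n => ℂ) i) := by
      funext x
      ext v
      conv_lhs => rw [pi_eq_sum_univ' v, map_sum]
      simp [mul_comm]
    rw [heq]
    exact Finset.aestronglyMeasurable_fun_sum _ fun i _ => (hcoord _).smul_const _
  -- The radius 2r leaves room for Cauchy's estimate on a ball of radius r about every point of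
  -- `ball z₀ r`, uniformly in x.
  have hlip : ∀ᵐ x ∂μ.restrict K,
      LipschitzOnWith (Real.nnabs (M / r)) (F · x) (ball z₀ r) := by
    filter_upwards [ae_restrict_mem hKm] with x hx
    refine (convex_ball z₀ r).lipschitzOnWith_of_nnnorm_fderiv_le (𝕜 := ℂ)
      (fun z hz => hdA x hx z (hrU (hsub z hz (mem_closedBall_self hr.le)))) fun z hz => ?_
    rw [← NNReal.coe_le_coe, Real.coe_nnabs, coe_nnnorm]
    exact (norm_fderiv_le_of_forall_closedBall hU (hd x hx) hr ((hsub z hz).trans hrU)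
      fun w hw => hM (w, x) ⟨hsub z hz hw, hx⟩).trans (le_abs_self _)
  have key := hasFDerivAt_integral_of_dominated_loc_of_lip (𝕜 := ℂ) (μ := μ.restrict K)
    (F := F) (F' := fun x => fderiv ℂ (F · x) z₀) (x₀ := z₀) (bound := fun _ => M / r)
    (ball_mem_nhds z₀ hr) ((hU.eventually_mem hz₀).mono hFm)
    ((hFc z₀ hz₀).integrableOn_of_subset_isCompact hK hKm le_rfl hμ) hmeas hlip
    (integrable_const _)
    (by filter_upwards [ae_restrict_mem hKm] with x hx using (hdA x hx z₀ hz₀).hasFDerivAt)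
  exact key.2.differentiableAt.differentiableWithinAt

/-- Directional derivatives of holomorphic functions are holomorphic. -/
theorem differentiableOn_fderiv_apply {n : ℕ} {U : Set (Fin n → ℂ)} (hU : IsOpen U)
    {h : (Fin n → ℂ) → ℂ} (hd : DifferentiableOn ℂ h U) (v : Fin n → ℂ) :
    DifferentiableOn ℂ (fun z => fderiv ℂ h z v) U := by
  intro z₀ hz₀
  obtain ⟨r, hr, hrU⟩ : ∃ r > 0, ball z₀ (2 * r) ⊆ U := by
    obtain ⟨s, hs, hsU⟩ := Metric.isOpen_iff.1 hU z₀ hz₀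
    exact ⟨s / 2, by positivity, by simpa [mul_div_cancel₀] using hsU⟩
  set R : ℝ := r / (‖v‖ + 1) with hR
  have hRpos : 0 < R := by positivity
  have hRv : R * ‖v‖ < r := by
    rw [hR, div_mul_eq_mul_div, div_lt_iff₀ (by positivity)]
    nlinarith
  have hmem : ∀ z ∈ ball z₀ r, ∀ ζ ∈ closedBall (0 : ℂ) R, z + ζ • v ∈ U := by
    intro z hz ζ hζ
    refine hrU (mem_ball.2 ?_)
    have h1 : ‖ζ • v‖ ≤ R * ‖v‖ := by
      rw [norm_smul]
      exact mul_le_mul_of_nonneg_right (mem_closedBall_zero_iff.1 hζ) (norm_nonneg _)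
    calc dist (z + ζ • v) z₀ ≤ dist (z + ζ • v) z + dist z z₀ := dist_triangle _ _ _
      _ < 2 * r := by
        have : dist (z + ζ • v) z = ‖ζ • v‖ := by simp [dist_eq_norm]
        linarith [mem_ball.1 hz]
  have hdA : ∀ z ∈ U, DifferentiableAt ℂ h z := fun z hz =>
    (hd z hz).differentiableAt (hU.mem_nhds hz)
  -- Cauchy's formula for the first derivative along v, with one radius R valid for all z near `z₀`.
  have hrep : ∀ z ∈ ball z₀ r, fderiv ℂ h z v = (2 * Real.pi * Complex.I : ℂ)⁻¹ •
      ∫ θ in Icc 0 (2 * Real.pi), deriv (circleMap 0 R) θ •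
        (((circleMap 0 R θ) ^ 2)⁻¹ • h (z + circleMap 0 R θ • v)) := by
    intro z hz
    have hdiff : DifferentiableOn ℂ (fun ζ : ℂ => h (z + ζ • v)) (closedBall 0 R) := by
      intro ζ hζ
      refine DifferentiableAt.differentiableWithinAt ?_
      exact (hdA _ (hmem z hz ζ hζ)).comp ζ (f := fun ζ : ℂ => z + ζ • v) (by fun_prop)
    have h1 := hdiff.deriv_eq_smul_circleIntegral hRpos
    have h2 : deriv (fun ζ : ℂ => h (z + ζ • v)) 0 = fderiv ℂ h z v :=
      ((hdA z (by simpa using hmem z hz 0 (mem_closedBall_self hRpos.le))).hasFDerivAt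
        |>.hasLineDerivAt v).lineDeriv
    rw [← h2, eq_inv_smul_iff₀ Complex.two_pi_I_ne_zero, ← h1, circleIntegral, intervalIntegral.integral_of_le (by positivity),
      integral_Icc_eq_integral_Ioc]
    simp
  have hcirc : ∀ θ, circleMap 0 R θ ∈ closedBall (0 : ℂ) R := fun θ =>
    sphere_subset_closedBall (circleMap_mem_sphere 0 hRpos.le θ)
  have hne : ∀ θ, circleMap 0 R θ ≠ 0 := fun θ => by
    simpa using circleMap_ne_center (c := 0) (θ := θ) hRpos.ne'
  have key : DifferentiableOn ℂ (fun z => ∫ θ in Icc 0 (2 * Real.pi), deriv (circleMap 0 R) θ •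
        (((circleMap 0 R θ) ^ 2)⁻¹ • h (z + circleMap 0 R θ • v))) (ball z₀ r) := by
    refine differentiableOn_setIntegral_of_isCompact isCompact_Icc measurableSet_Icc
      measure_Icc_lt_top.ne isOpen_ball ?_ ?_
    · have hc : ContinuousOn (fun p : (Fin n → ℂ) × ℝ => h (p.1 + circleMap 0 R p.2 • v))
          (ball z₀ r ×ˢ Icc 0 (2 * Real.pi)) :=
        hd.continuousOn.comp (f := fun p : (Fin n → ℂ) × ℝ => p.1 + circleMap 0 R p.2 • v)
          (by fun_prop) fun p hp => hmem _ hp.1 _ (hcirc _)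
      have h2 : Continuous fun p : (Fin n → ℂ) × ℝ => ((circleMap 0 R p.2) ^ 2)⁻¹ :=
        Continuous.inv₀ (by fun_prop) fun p => pow_ne_zero 2 (hne _)
      have h3 : Continuous fun p : (Fin n → ℂ) × ℝ => deriv (circleMap 0 R) p.2 := by
        simp only [deriv_circleMap]; fun_prop
      exact h3.continuousOn.smul (h2.continuousOn.smul hc)
    · intro θ _ z hz
      refine DifferentiableAt.differentiableWithinAt ?_
      refine DifferentiableAt.fun_const_smul (DifferentiableAt.fun_const_smul ?_ _) _
      exact (hdA _ (hmem z hz _ (hcirc θ))).comp z (f := fun z => z + circleMap 0 R θ • v)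
        (by fun_prop)
  have hb := ball_mem_nhds z₀ hr
  refine DifferentiableAt.differentiableWithinAt ?_
  refine DifferentiableAt.congr_of_eventuallyEq
    (((key z₀ (mem_ball_self hr)).differentiableAt hb).fun_const_smul
      (2 * Real.pi * Complex.I : ℂ)⁻¹) ?_
  filter_upwards [hb] with z hz using hrep z hz

/-- Identity theorem for holomorphic functions of several variables. -/
theorem eqOn_zero_of_differentiableOn_of_eventually_eq_zero {E : Type*} [NormedAddCommGroup E]
    [NormedSpace ℂ E] {U : Set E} (hU : IsOpen U) (hc : IsPreconnected U)
    {h : E → ℂ} (hd : DifferentiableOn ℂ h U) {z₀ : E} (hz₀ : z₀ ∈ U)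
    (h0 : ∀ᶠ z in 𝓝 z₀, h z = 0) : ∀ z ∈ U, h z = 0 := by
  -- The set of points near which h vanishes is open; it remains to see that it is closed in U.
  have hsub : U ⊆ {z | ∀ᶠ w in 𝓝 z, h w = 0} := by
    refine hc.subset_of_closure_inter_subset isOpen_setOfPred_eventually_nhds ⟨z₀, hz₀, h0⟩ ?_
    rintro z ⟨hzc, hzU⟩
    obtain ⟨r, hr, hrU⟩ := Metric.isOpen_iff.1 hU z hzU
    obtain ⟨s, hs, hsz⟩ := Metric.mem_closure_iff.1 hzc r hr
    have hsb : s ∈ ball z r := by rwa [mem_ball, dist_comm]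
    show ∀ᶠ w in 𝓝 z, h w = 0
    filter_upwards [ball_mem_nhds z hr] with w hw
    -- The complex line with L 0 = s, near which h vanishes, and L 1 = w. Its trace on the ball is
    -- convex, so the one-variable identity theorem carries the vanishing to w.
    set L : ℂ → E := fun ζ => s + ζ • (w - s) with hL
    set V : Set ℂ := L ⁻¹' ball z r with hV
    have hLc : Continuous L := by fun_prop
    have hVo : IsOpen V := isOpen_ball.preimage hLc
    have hVc : IsPreconnected V := by
      refine Convex.isPreconnected ?_
      intro a ha b hb t u ht hu htu
      have : L (t • a + u • b) = t • L a + u • L b := by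
        simp only [hL, smul_add, add_smul, smul_assoc]
        have : s = t • s + u • s := by rw [← add_smul, htu, one_smul]
        nth_rewrite 1 [this]
        abel
      show L (t • a + u • b) ∈ ball z r
      rw [this]
      exact convex_ball z r ha hb ht hu htu
    have hLd : DifferentiableOn ℂ (h ∘ L) V := by
      intro ζ hζ
      exact (((hd _ (hrU hζ)).differentiableAt (hU.mem_nhds (hrU hζ))).comp ζ
        (by fun_prop : DifferentiableAt ℂ L ζ)).differentiableWithinAt
    have hev : (h ∘ L) =ᶠ[𝓝 0] 0 := by
      have : Tendsto L (𝓝 0) (𝓝 s) := by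
        simpa [hL] using hLc.tendsto 0
      exact this.eventually hs
    have h1 := (hLd.analyticOnNhd hVo).eqOn_zero_of_preconnected_of_eventuallyEq_zero hVc
      (z₀ := 0) (by simpa [hV, hL] using hsb) hev
    have h2 := h1 (x := 1) (by simpa [hV, hL] using hw)
    simpa [hL] using h2
  exact fun z hz => (hsub hz).self_of_nhds

/-! ### Jacobian determinants. -/

/-- The complex Jacobian determinant of a holomorphic map. -/
noncomputable def jacobianDet {n : ℕ} (f : (Fin n → ℂ) → (Fin n → ℂ)) (z : Fin n → ℂ) : ℂ :=
  (fderiv ℂ f z).det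

theorem differentiableOn_jacobianDet {n : ℕ} {U : Set (Fin n → ℂ)} (hU : IsOpen U)
    {f : (Fin n → ℂ) → (Fin n → ℂ)} (hd : DifferentiableOn ℂ f U) :
    DifferentiableOn ℂ (jacobianDet f) U := by
  have hcomp : ∀ i, DifferentiableOn ℂ (fun z => f z i) U := differentiableOn_pi.1 hd
  have h1 : ∀ i j, DifferentiableOn ℂ (fun z => fderiv ℂ (fun z => f z i) z (Pi.single j 1)) U :=
    fun i j => differentiableOn_fderiv_apply hU (hcomp i) _
  have h2 : DifferentiableOn ℂ (fun z => (Matrix.of fun i j =>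
      fderiv ℂ (fun z => f z i) z (Pi.single j 1)).det) U := by
    simp only [Matrix.det_apply, Matrix.of_apply]
    refine DifferentiableOn.fun_sum fun σ _ => DifferentiableOn.fun_const_smul ?_ _
    exact fun z hz => (HasFDerivWithinAt.finsetProd fun i _ =>
      (h1 (σ i) i z hz).hasFDerivWithinAt).differentiableWithinAt
  refine h2.congr fun z hz => ?_
  have hz' := (hd z hz).differentiableAt (hU.mem_nhds hz)
  rw [jacobianDet, ContinuousLinearMap.det, ← LinearMap.det_toMatrix']
  congr 1
  ext i j
  have h3 : HasFDerivAt (fun z => f z i) ((ContinuousLinearMap.proj i).comp (fderiv ℂ f z)) z :=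
    hasFDerivAt_pi'.1 hz'.hasFDerivAt i
  simp [LinearMap.toMatrix'_apply, h3.fderiv]

/-! ### The weighted action and its extension to complex scalars. -/

/-- The extension of the weighted circle action to complex scalars. -/
noncomputable def weightedScale {n : ℕ} (m : Fin n → ℕ) (ζ : ℂ) (z : Fin n → ℂ) : Fin n → ℂ :=
  fun i => ζ ^ m i * z i

/-- `h` has weight `k` on `D` with respect to the weighted circle action. -/
def HasWeightOn {n : ℕ} (m : Fin n → ℕ) (k : ℤ) (h : (Fin n → ℂ) → ℂ) (D : Set (Fin n → ℂ)) :
    Prop :=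
  ∀ t : Circle, ∀ z ∈ D, h (weightedCircleAction m t z) = (t : ℂ) ^ k * h z

section Action

variable {n : ℕ} {m : Fin n → ℕ}

theorem weightedCircleAction_mul (s t : Circle) (z : Fin n → ℂ) :
    weightedCircleAction m s (weightedCircleAction m t z) = weightedCircleAction m (s * t) z := by
  funext i
  simp [weightedCircleAction, mul_pow, mul_assoc]

theorem weightedCircleAction_one (z : Fin n → ℂ) : weightedCircleAction m 1 z = z := by
  funext i
  simp [weightedCircleAction]

theorem norm_weightedCircleAction (t : Circle) (z : Fin n → ℂ) :
    ‖weightedCircleAction m t z‖ = ‖z‖ := by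
  have ht : ‖(t : ℂ)‖₊ = 1 := by
    ext
    exact t.norm_coe
  simp [Pi.norm_def, weightedCircleAction, nnnorm_mul, ht]

theorem continuous_weightedCircleAction :
    Continuous fun p : Circle × (Fin n → ℂ) => weightedCircleAction m p.1 p.2 := by
  unfold weightedCircleAction
  fun_prop

theorem differentiable_weightedCircleAction (t : Circle) :
    Differentiable ℂ (weightedCircleAction m t) := by
  unfold weightedCircleAction
  fun_prop

theorem norm_weightedScale_le {ζ : ℂ} (hζ : ‖ζ‖ ≤ 1) {a : ℕ} (ha : ∀ i, a ≤ m i)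
    (z : Fin n → ℂ) : ‖weightedScale m ζ z‖ ≤ ‖ζ‖ ^ a * ‖z‖ := by
  refine (pi_norm_le_iff_of_nonneg (by positivity)).2 fun i => ?_
  rw [weightedScale, norm_mul, norm_pow]
  exact mul_le_mul (pow_le_pow_of_le_one (norm_nonneg _) hζ (ha i)) (norm_le_pi_norm z i)
    (norm_nonneg _) (by positivity)

theorem differentiable_weightedScale (z : Fin n → ℂ) :
    Differentiable ℂ fun ζ => weightedScale m ζ z := by
  unfold weightedScale
  fun_prop

end Action

/-! ### Functions of a given weight near the origin. -/

section Local

variable {n : ℕ} {m : Fin n → ℕ} {h : (Fin n → ℂ) → ℂ} {R : ℝ}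

theorem weightedScale_mem_ball {z : Fin n → ℂ} (hz : z ∈ ball 0 R) {ζ : ℂ} (hζ : ‖ζ‖ ≤ 1) :
    weightedScale m ζ z ∈ ball 0 R := by
  have := norm_weightedScale_le (m := m) hζ (fun i => Nat.zero_le _) z
  rw [mem_ball_zero_iff] at *
  simp at this
  linarith

theorem diffContOnCl_comp_weightedScale (hd : DifferentiableOn ℂ h (ball 0 R)) {z : Fin n → ℂ}
    (hz : z ∈ ball 0 R) : DiffContOnCl ℂ (fun ζ => h (weightedScale m ζ z)) (ball 0 1) := by
  apply DifferentiableOn.diffContOnCl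
  rw [closure_ball _ one_ne_zero]
  intro ζ hζ
  have := weightedScale_mem_ball (m := m) hz (mem_closedBall_zero_iff.1 hζ)
  exact (((hd _ this).differentiableAt (isOpen_ball.mem_nhds this)).comp ζ
    (differentiable_weightedScale z ζ)).differentiableWithinAt

/-- Both sides are holomorphic in ζ on the unit disc and agree on its boundary circle. -/
theorem HasWeightOn.apply_weightedScale {k : ℕ} (hd : DifferentiableOn ℂ h (ball 0 R))
    (hh : HasWeightOn m k h (ball 0 R)) {z : Fin n → ℂ} (hz : z ∈ ball 0 R) {ζ : ℂ}
    (hζ : ‖ζ‖ ≤ 1) : h (weightedScale m ζ z) = ζ ^ k * h z := by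
  have key := Complex.eqOn_closure_of_eqOn_frontier (U := ball (0 : ℂ) 1)
    (f := fun ζ => h (weightedScale m ζ z)) (g := fun ζ => ζ ^ k * h z) isBounded_ball
    (diffContOnCl_comp_weightedScale hd hz)
    (Differentiable.diffContOnCl (by fun_prop)) (by
      intro ξ hξ
      rw [frontier_ball _ one_ne_zero] at hξ
      have h1 : h (weightedScale m ξ z) = ξ ^ (k : ℤ) * h z := hh ⟨ξ, hξ⟩ z hz
      simpa using h1)
  exact key (by rwa [closure_ball _ one_ne_zero, mem_closedBall_zero_iff])

/-- On the unit circle ζ^(k+1) · h(ζ·z) is the constant h z, hence also on the disc; at ζ = 0 it is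
0. -/
theorem HasWeightOn.eq_zero_of_neg {k : ℕ} (hd : DifferentiableOn ℂ h (ball 0 R))
    (hh : HasWeightOn m (-(k + 1 : ℕ)) h (ball 0 R)) {z : Fin n → ℂ} (hz : z ∈ ball 0 R) :
    h z = 0 := by
  have key := Complex.eqOn_closure_of_eqOn_frontier (U := ball (0 : ℂ) 1)
    (f := fun ζ => ζ ^ (k + 1) * h (weightedScale m ζ z)) (g := fun ζ => h z) isBounded_ball
    ((Differentiable.diffContOnCl (f := fun ζ : ℂ => ζ ^ (k + 1)) (by fun_prop)).smul
      (diffContOnCl_comp_weightedScale hd hz))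
    (Differentiable.diffContOnCl (by fun_prop)) (by
      intro ξ hξ
      rw [frontier_ball _ one_ne_zero] at hξ
      have h1 : h (weightedScale m ξ z) = ξ ^ (-((k + 1 : ℕ) : ℤ)) * h z := hh ⟨ξ, hξ⟩ z hz
      have h2 : ξ ≠ 0 := by
        rintro rfl
        simp at hξ
      simp only [h1, zpow_neg, zpow_natCast]
      field_simp)
  have := key (x := 0) (subset_closure (mem_ball_self one_pos))
  simpa using this.symm

end Local

/-! ### Functions of a given weight on a quasi-circular domain. -/

section Domain

variable {n : ℕ} {m : Fin n → ℕ} {D : Set (Fin n → ℂ)} {h : (Fin n → ℂ) → ℂ}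

theorem IsBoundedQuasiCircularDomain.exists_ball_subset (hD : IsBoundedQuasiCircularDomain m D) :
    ∃ R > 0, ball 0 R ⊆ D :=
  Metric.isOpen_iff.1 hD.isOpen 0 hD.zero_mem

theorem HasWeightOn.mono {k : ℤ} {D₁ : Set (Fin n → ℂ)} (hh : HasWeightOn m k h D)
    (hs : D₁ ⊆ D) : HasWeightOn m k h D₁ :=
  fun t z hz => hh t z (hs hz)

theorem HasWeightOn.eqOn_zero_of_neg (hD : IsBoundedQuasiCircularDomain m D)
    (hd : DifferentiableOn ℂ h D) {k : ℤ} (hk : k < 0) (hh : HasWeightOn m k h D) :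
    ∀ z ∈ D, h z = 0 := by
  obtain ⟨R, hR, hRD⟩ := hD.exists_ball_subset
  obtain ⟨j, rfl⟩ : ∃ j : ℕ, k = -((j + 1 : ℕ) : ℤ) := ⟨(-k - 1).toNat, by omega⟩
  refine eqOn_zero_of_differentiableOn_of_eventually_eq_zero hD.isOpen hD.isConnected.isPreconnected
    hd hD.zero_mem ?_
  filter_upwards [ball_mem_nhds 0 hR] with z hz
  exact HasWeightOn.eq_zero_of_neg (hd.mono hRD) (hh.mono hRD) hz

theorem HasWeightOn.fderiv_single (hD : IsBoundedQuasiCircularDomain m D)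
    (hd : DifferentiableOn ℂ h D) {k : ℤ} (hh : HasWeightOn m k h D) (i : Fin n) :
    HasWeightOn m (k - m i) (fun z => fderiv ℂ h z (Pi.single i 1)) D := by
  intro t z hz
  set L : (Fin n → ℂ) →L[ℂ] (Fin n → ℂ) :=
    ContinuousLinearMap.pi fun i => ((t : ℂ) ^ m i) • ContinuousLinearMap.proj i with hL
  have hLt : ∀ w, weightedCircleAction m t w = L w := fun w => by
    funext i
    simp [hL, weightedCircleAction]
  have hdA : ∀ w ∈ D, HasFDerivAt h (fderiv ℂ h w) w := fun w hw =>
    ((hd w hw).differentiableAt (hD.isOpen.mem_nhds hw)).hasFDerivAt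
  have h1 : HasFDerivAt (fun w => h (L w)) ((fderiv ℂ h (L z)).comp L) z :=
    (hdA (L z) (hLt z ▸ hD.invariant t z hz)).comp z L.hasFDerivAt
  have h2 : HasFDerivAt (fun w => h (L w)) (((t : ℂ) ^ k) • fderiv ℂ h z) z := by
    refine ((hdA z hz).const_smul ((t : ℂ) ^ k)).congr_of_eventuallyEq ?_
    filter_upwards [hD.isOpen.mem_nhds hz] with w hw
    rw [← hLt, hh t w hw]
    rfl
  have h3 := congrArg (fun A : (Fin n → ℂ) →L[ℂ] ℂ => A (Pi.single i 1)) (h1.unique h2)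
  have h4 : L (Pi.single i 1) = ((t : ℂ) ^ m i) • Pi.single i (1 : ℂ) := by
    funext j
    by_cases hj : j = i
    · subst hj; simp [hL]
    · simp [hL, hj]
  simp only [ContinuousLinearMap.comp_apply, h4, map_smul, smul_apply,
    smul_eq_mul] at h3
  have ht : (t : ℂ) ≠ 0 := t.coe_ne_zero
  rw [hLt, zpow_sub₀ ht, zpow_natCast, div_mul_eq_mul_div, eq_div_iff (pow_ne_zero _ ht), ← h3,
    mul_comm]

/-- Euler's identity for functions of weight `k`. -/
theorem HasWeightOn.sum_fderiv_single (hD : IsBoundedQuasiCircularDomain m D)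
    (hd : DifferentiableOn ℂ h D) {k : ℤ} (hh : HasWeightOn m k h D) {z : Fin n → ℂ}
    (hz : z ∈ D) : ∑ i, (m i : ℂ) * z i * fderiv ℂ h z (Pi.single i 1) = k * h z := by
  have hE : ∀ c : ℂ, HasDerivAt (fun θ : ℝ => Complex.exp (c * (θ * Complex.I)))
      (c * Complex.I) 0 := by
    intro c
    have h1 : HasDerivAt (fun θ : ℝ => c * ((θ : ℂ) * Complex.I)) (c * Complex.I) 0 := by
      simpa using (((hasDerivAt_id (0 : ℝ)).ofReal_comp).mul_const Complex.I).const_mul c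
    simpa using h1.cexp
  -- Along this orbit h equals e^(ikθ) h(z); Euler's identity compares the two derivatives at θ = 0.
  set γ : ℝ → Fin n → ℂ := fun θ => weightedCircleAction m (Circle.exp θ) z with hγ
  have hγ0 : γ 0 = z := by simp [hγ, weightedCircleAction_one]
  have hγd : HasDerivAt γ (fun i => (m i * Complex.I) * z i) 0 := by
    refine hasDerivAt_pi.2 fun i => ?_
    have := (hE (m i)).mul_const (z i)
    refine this.congr_of_eventuallyEq (Eventually.of_forall fun θ => ?_)
    simp [hγ, weightedCircleAction, ← Complex.exp_nat_mul]
  have h1 : HasDerivAt (h ∘ γ) (fderiv ℂ h z fun i => (m i * Complex.I) * z i) 0 := by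
    have h2 : HasFDerivAt h (fderiv ℂ h z) (γ 0) := by
      rw [hγ0]
      exact ((hd z hz).differentiableAt (hD.isOpen.mem_nhds hz)).hasFDerivAt
    simpa using (h2.restrictScalars ℝ).comp_hasDerivAt (0 : ℝ) hγd
  have h2 : HasDerivAt (h ∘ γ) ((k * Complex.I) * h z) 0 := by
    refine ((hE k).mul_const (h z)).congr_of_eventuallyEq (Eventually.of_forall fun θ => ?_)
    simp [hγ, hh _ z hz, ← Complex.exp_int_mul]
  have h3 := h1.unique h2
  rw [pi_eq_sum_univ' (fun i => (m i * Complex.I) * z i), map_sum] at h3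
  simp only [map_smul, smul_eq_mul] at h3
  have h4 : Complex.I * ∑ i, (m i : ℂ) * z i * fderiv ℂ h z (Pi.single i 1) =
      Complex.I * (k * h z) := by
    rw [Finset.mul_sum, ← mul_assoc, mul_comm Complex.I, ← h3]
    refine Finset.sum_congr rfl fun i _ => ?_
    ring_nf
  exact mul_left_cancel₀ Complex.I_ne_zero h4

/-- A holomorphic function of weight `k ≥ 0` is a polynomial. -/
theorem HasWeightOn.exists_mvPolynomial (hD : IsBoundedQuasiCircularDomain m D)
    {a : ℕ} (ha0 : 0 < a) (ha : ∀ i, a ≤ m i) (k : ℕ) :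
    ∀ {h : (Fin n → ℂ) → ℂ}, DifferentiableOn ℂ h D → HasWeightOn m k h D →
      ∃ P : MvPolynomial (Fin n) ℂ, (∀ z ∈ D, h z = MvPolynomial.eval z P) ∧
        P.totalDegree * a ≤ k := by
  -- The i-th partial derivative has weight k - m i < k, and Euler's identity recovers h from these
  -- when k > 0. For k = 0 they all have negative weight, so h is constant.
  induction k using Nat.strong_induction_on with
  | _ k ih =>
  intro h hd hh
  have hdi := fun i => differentiableOn_fderiv_apply hD.isOpen hd (Pi.single i 1)
  have hwi := fun i => hh.fderiv_single hD hd i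
  rcases Nat.eq_zero_or_pos k with rfl | hk
  · have hz : ∀ z ∈ D, ∀ i, fderiv ℂ h z (Pi.single i 1) = 0 := fun z hz i =>
      (hwi i).eqOn_zero_of_neg hD (hdi i) (by have := ha i; omega) z hz
    have hf : EqOn (fderiv ℂ h) 0 D := fun z hzD => by
      ext v
      conv_lhs => rw [pi_eq_sum_univ' v, map_sum]
      simpa using Finset.sum_eq_zero fun i _ => by
        have := hz z hzD i
        simp [this]
    refine ⟨MvPolynomial.C (h 0), fun z hzD => ?_, by simp⟩
    rw [MvPolynomial.eval_C]
    exact hD.isOpen.is_const_of_fderiv_eq_zero hD.isConnected.isPreconnected hd hf hzD hD.zero_mem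
  -- Bounding the degree of X_i · P rather than of P also covers m i > k, where P = 0.
  · have hP : ∀ i, ∃ P : MvPolynomial (Fin n) ℂ,
        (∀ z ∈ D, fderiv ℂ h z (Pi.single i 1) = MvPolynomial.eval z P) ∧
        (MvPolynomial.X i * P).totalDegree * a ≤ k := by
      intro i
      by_cases hi : m i ≤ k
      · have hlt : k - m i < k := by have := ha i; omega
        obtain ⟨P, hP, hPd⟩ := ih (k - m i) hlt (hdi i) (by
          have := hwi i
          rwa [← Nat.cast_sub hi] at this)
        refine ⟨P, hP, ?_⟩
        have h1 : (MvPolynomial.X i * P).totalDegree ≤ 1 + P.totalDegree := by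
          simpa using MvPolynomial.totalDegree_mul (MvPolynomial.X i) P
        have := ha i
        calc _ ≤ (1 + P.totalDegree) * a := Nat.mul_le_mul_right _ h1
          _ = a + P.totalDegree * a := by ring
          _ ≤ k := by omega
      · refine ⟨0, fun z hz => ?_, by simp⟩
        rw [map_zero]
        exact (hwi i).eqOn_zero_of_neg hD (hdi i) (by omega) z hz
    choose P hP hPd using hP
    refine ⟨MvPolynomial.C ((k : ℂ)⁻¹) * ∑ i, MvPolynomial.C (m i : ℂ) * (MvPolynomial.X i * P i),
      fun z hz => ?_, ?_⟩
    · have h1 := hh.sum_fderiv_single hD hd hz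
      have hk' : (k : ℂ) ≠ 0 := by exact_mod_cast hk.ne'
      rw [map_mul, map_sum, MvPolynomial.eval_C, eq_inv_mul_iff_mul_eq₀ hk']
      push_cast at h1
      rw [← h1]
      refine Finset.sum_congr rfl fun i _ => ?_
      simp [hP i z hz, mul_assoc]
    · have hC : ∀ (c : ℂ) (Q : MvPolynomial (Fin n) ℂ),
          (MvPolynomial.C c * Q).totalDegree ≤ Q.totalDegree := fun c Q => by
        simpa using MvPolynomial.totalDegree_mul (MvPolynomial.C c) Q
      rw [← Nat.le_div_iff_mul_le ha0]
      refine (hC _ _).trans (MvPolynomial.totalDegree_finsetSum_le fun i _ => (hC _ _).trans ?_)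
      exact (Nat.le_div_iff_mul_le ha0).2 (hPd i)

/-- Write z = t·w with t^b = ‖z‖ / R. Since t ≤ 1 and m i ≤ b, w stays in the closed ball of radius
R, where h is bounded, and h z = t^k h w. Raising to the power b avoids fractional exponents in the
statement. -/
theorem HasWeightOn.exists_norm_pow_le (hD : IsBoundedQuasiCircularDomain m D)
    (hd : DifferentiableOn ℂ h D) {k : ℕ} (hh : HasWeightOn m k h D) {b : ℕ} (hb0 : 0 < b)
    (hb : ∀ i, m i ≤ b) : ∃ C ≥ 0, ∀ᶠ z in 𝓝 (0 : Fin n → ℂ), ‖h z‖ ^ b ≤ C * ‖z‖ ^ k := by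
  obtain ⟨S, hS, hSD⟩ := hD.exists_ball_subset
  set R := S / 2 with hR
  have hRpos : 0 < R := by positivity
  have hRS : closedBall (0 : Fin n → ℂ) R ⊆ ball 0 S := closedBall_subset_ball (by linarith)
  obtain ⟨B, hB⟩ := (isCompact_closedBall (0 : Fin n → ℂ) R).exists_bound_of_continuousOn
    (hd.continuousOn.mono (hRS.trans hSD))
  have hB0 : 0 ≤ B := (norm_nonneg _).trans (hB 0 (mem_closedBall_self hRpos.le))
  refine ⟨B ^ b / R ^ k, by positivity, ?_⟩
  filter_upwards [ball_mem_nhds 0 hRpos] with z hz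
  rw [mem_ball_zero_iff] at hz
  set t : ℝ := (‖z‖ / R) ^ (1 / (b : ℝ)) with ht
  have ht0 : 0 ≤ t := by positivity
  have htb : t ^ b = ‖z‖ / R := by
    rw [ht, ← Real.rpow_natCast, ← Real.rpow_mul (by positivity)]
    simp [hb0.ne']
  have ht1 : t ≤ 1 := Real.rpow_le_one (by positivity) (by rw [div_le_one hRpos]; exact hz.le)
    (by positivity)
  set w : Fin n → ℂ := weightedScale m (t : ℂ)⁻¹ z with hw
  have htz : z ≠ 0 → t ≠ 0 := fun hz0 => by
    have : 0 < ‖z‖ := norm_pos_iff.2 hz0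
    positivity
  have hzw : z = weightedScale m t w := by
    rcases eq_or_ne z 0 with rfl | hz0
    · funext i; simp [hw, weightedScale]
    · funext i
      have : (t : ℂ) ≠ 0 := by exact_mod_cast htz hz0
      simp only [hw, weightedScale]
      rw [inv_pow, mul_inv_cancel_left₀ (pow_ne_zero _ this)]
  have hwR : w ∈ closedBall 0 R := by
    rw [mem_closedBall_zero_iff]
    refine (pi_norm_le_iff_of_nonneg hRpos.le).2 fun i => ?_
    rcases eq_or_ne z 0 with rfl | hz0
    · simpa [hw, weightedScale] using hRpos.le
    · have htp : 0 < t := ht0.lt_of_ne' (htz hz0)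
      have h1 : ‖w i‖ = (t ^ m i)⁻¹ * ‖z i‖ := by
        simp [hw, weightedScale, abs_of_pos htp]
      have h2 : ‖z i‖ ≤ R * t ^ m i := by
        calc ‖z i‖ ≤ ‖z‖ := norm_le_pi_norm z i
          _ = R * t ^ b := by rw [htb]; field_simp
          _ ≤ R * t ^ m i :=
            mul_le_mul_of_nonneg_left (pow_le_pow_of_le_one ht0 ht1 (hb i)) hRpos.le
      rw [h1, inv_mul_le_iff₀ (by positivity)]
      linarith
  have hval : h z = (t : ℂ) ^ k * h w := by
    conv_lhs => rw [hzw]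
    exact (hh.mono hSD).apply_weightedScale (hd.mono hSD) (hRS hwR)
      (by simpa [abs_of_nonneg ht0] using ht1)
  calc ‖h z‖ ^ b = (t ^ b) ^ k * ‖h w‖ ^ b := by
        rw [hval, norm_mul, norm_pow, Complex.norm_real, Real.norm_of_nonneg ht0, mul_pow,
          ← pow_mul, ← pow_mul, mul_comm k]
    _ ≤ (‖z‖ / R) ^ k * B ^ b := by
        rw [htb]
        gcongr
        exact hB w hwR
    _ = _ := by rw [div_pow]; ring

end Domain

/-! ### Weight components. -/

section Component

variable {n : ℕ} {m : Fin n → ℕ} {D : Set (Fin n → ℂ)} {h : (Fin n → ℂ) → ℂ}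

/-- The component of weight `k` of `h`, obtained by averaging over the circle action. -/
noncomputable def weightComponent (m : Fin n → ℕ) (k : ℤ) (h : (Fin n → ℂ) → ℂ)
    (z : Fin n → ℂ) : ℂ :=
  fourierCoeff (fun x : UnitAddCircle => h (weightedCircleAction m x.toCircle z)) k

theorem continuous_weightedCircleAction_toCircle :
    Continuous fun p : (Fin n → ℂ) × UnitAddCircle =>
      weightedCircleAction m p.2.toCircle p.1 :=
  continuous_weightedCircleAction.comp
    ((AddCircle.continuous_toCircle.comp continuous_snd).prodMk continuous_fst)

theorem continuousOn_comp_weightedCircleAction (hD : IsBoundedQuasiCircularDomain m D)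
    (hc : ContinuousOn h D) : ContinuousOn (fun p : (Fin n → ℂ) × UnitAddCircle =>
      h (weightedCircleAction m p.2.toCircle p.1)) (D ×ˢ univ) :=
  hc.comp continuous_weightedCircleAction_toCircle.continuousOn
    fun _ hp => hD.invariant _ _ hp.1

theorem continuous_orbit (hD : IsBoundedQuasiCircularDomain m D)
    (hc : ContinuousOn h D) {z : Fin n → ℂ} (hz : z ∈ D) :
    Continuous fun x : UnitAddCircle => h (weightedCircleAction m x.toCircle z) := by
  rw [← continuousOn_univ]
  exact (continuousOn_comp_weightedCircleAction hD hc).comp (f := fun x => (z, x))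
    (by fun_prop) fun x hx => ⟨hz, hx⟩

theorem differentiableOn_weightComponent (hD : IsBoundedQuasiCircularDomain m D)
    (hd : DifferentiableOn ℂ h D) (k : ℤ) : DifferentiableOn ℂ (weightComponent m k h) D := by
  have := differentiableOn_setIntegral_of_isCompact (μ := AddCircle.haarAddCircle (T := 1))
    (K := univ) isCompact_univ MeasurableSet.univ (measure_ne_top _ _) hD.isOpen
    (F := fun z x => fourier (-k) x • h (weightedCircleAction m x.toCircle z)) ?_ ?_
  · rw [Measure.restrict_univ] at this
    exact this
  · exact ((map_continuous (fourier (-k))).comp continuous_snd).continuousOn.smul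
      (continuousOn_comp_weightedCircleAction hD hd.continuousOn)
  · intro x _
    exact (hd.comp (differentiable_weightedCircleAction x.toCircle).differentiableOn
      (fun z hz => hD.invariant _ z hz)).const_smul (fourier (-k) x)

/-- Translation invariance of Haar measure on the circle. -/
theorem hasWeightOn_weightComponent (k : ℤ) (D : Set (Fin n → ℂ)) :
    HasWeightOn m k (weightComponent m k h) D := by
  intro t z _
  obtain ⟨y, rfl⟩ := (AddCircle.homeomorphCircle (T := 1) one_ne_zero).surjective t
  simp only [AddCircle.homeomorphCircle_apply, weightComponent, fourierCoeff,
    weightedCircleAction_mul, ← AddCircle.toCircle_add]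
  rw [← integral_const_mul]
  rw [← integral_add_right_eq_self (fun x : UnitAddCircle => ((y.toCircle : Circle) : ℂ) ^ k *
    (fourier (-k) x • h (weightedCircleAction m x.toCircle z))) y]
  congr 1
  funext x
  have h1 : fourier (-k) (x + y) = fourier (-k) x * fourier (-k) y := by
    simp [fourier_apply, smul_add, AddCircle.toCircle_add]
  have h2 : (((y.toCircle : Circle) : ℂ) ^ k) * fourier (-k) y = 1 := by
    rw [fourier_apply, AddCircle.toCircle_zsmul]
    simp [zpow_neg, mul_inv_cancel₀ (zpow_ne_zero k (y.toCircle.coe_ne_zero))]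
  rw [h1, smul_eq_mul, smul_eq_mul]
  linear_combination (-(fourier (-k) x * h (weightedCircleAction m (x + y).toCircle z))) * h2

/-- The components are the Fourier coefficients of h along the orbit of z. With finite support the
series converges to the continuous orbit function, which takes the value h z at 0. -/
theorem eq_sum_weightComponent (hD : IsBoundedQuasiCircularDomain m D)
    (hc : ContinuousOn h D) {z : Fin n → ℂ} (hz : z ∈ D) (S : Finset ℤ)
    (hS : ∀ k ∉ S, weightComponent m k h z = 0) : h z = ∑ k ∈ S, weightComponent m k h z := by
  set g : C(UnitAddCircle, ℂ) := ⟨_, continuous_orbit hD hc hz⟩ with hg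
  have hS' : ∀ k ∉ S, fourierCoeff g k = 0 := hS
  have h1 := has_pointwise_sum_fourier_series_of_summable (f := g)
    (summable_of_ne_finset_zero (s := S) hS') 0
  have h2 := hasSum_sum_of_ne_finset_zero (s := S) (L := SummationFilter.unconditional ℤ) (f := fun i => fourierCoeff g i • fourier i (0 : UnitAddCircle))
    (fun k hk => by rw [hS' k hk, zero_smul])
  have h3 := h1.unique h2
  simpa [hg, weightedCircleAction_one, weightComponent] using h3

theorem norm_weightComponent_le {k : ℤ} {z : Fin n → ℂ} {c : ℝ}
    (hc : ∀ t : Circle, ‖h (weightedCircleAction m t z)‖ ≤ c) :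
    ‖weightComponent m k h z‖ ≤ c := by
  have := norm_integral_le_of_norm_le_const (μ := AddCircle.haarAddCircle (T := 1)) (C := c)
    (f := fun x : UnitAddCircle => fourier (-k) x • h (weightedCircleAction m x.toCircle z))
    (Eventually.of_forall fun x => by
      rw [norm_smul, fourier_apply, Circle.norm_coe, one_mul]
      exact hc _)
  simpa [weightComponent, fourierCoeff] using this

/-- If `h` vanishes to high enough order at the origin, then its low weight components vanish. -/
theorem weightComponent_eq_zero_of_norm_pow_le (hD : IsBoundedQuasiCircularDomain m D)
    (hd : DifferentiableOn ℂ h D) {a b j k : ℕ} (ha : ∀ i, a ≤ m i) (hb : 0 < b) {C : ℝ}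
    (hC : 0 ≤ C) (hh : ∀ᶠ z in 𝓝 (0 : Fin n → ℂ), ‖h z‖ ^ b ≤ C * ‖z‖ ^ k)
    (hlt : j * b < a * k) : ∀ z ∈ D, weightComponent m j h z = 0 := by
  have hqd := differentiableOn_weightComponent hD hd j
  have hqw := hasWeightOn_weightComponent (m := m) (h := h) (j : ℤ) D
  refine eqOn_zero_of_differentiableOn_of_eventually_eq_zero hD.isOpen hD.isConnected.isPreconnected
    hqd hD.zero_mem ?_
  obtain ⟨R₁, hR₁, hR₁D⟩ := hD.exists_ball_subset
  obtain ⟨R₂, hR₂, hR₂h⟩ := Metric.eventually_nhds_iff_ball.1 hh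
  have hR : 0 < min R₁ R₂ := lt_min hR₁ hR₂
  have hsub := (ball_subset_ball (x := (0 : Fin n → ℂ)) (min_le_left R₁ R₂)).trans hR₁D
  -- The action preserves the sup norm, so the bound on h survives averaging.
  have hbound : ∀ z ∈ ball (0 : Fin n → ℂ) (min R₁ R₂),
      ‖weightComponent m j h z‖ ^ b ≤ C * ‖z‖ ^ k := by
    intro z hz
    have hpos : 0 ≤ C * ‖z‖ ^ k := by positivity
    have h1 : ‖weightComponent m j h z‖ ≤ (C * ‖z‖ ^ k) ^ (1 / (b : ℝ)) := by
      refine norm_weightComponent_le fun t => ?_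
      have hz' : weightedCircleAction m t z ∈ ball (0 : Fin n → ℂ) R₂ := by
        rw [mem_ball_zero_iff, norm_weightedCircleAction]
        exact (mem_ball_zero_iff.1 hz).trans_le (min_le_right _ _)
      have h2 := hR₂h _ hz'
      rw [norm_weightedCircleAction] at h2
      rw [one_div]
      refine (Real.le_rpow_inv_iff_of_pos (norm_nonneg _) hpos (by positivity)).2 ?_
      rwa [Real.rpow_natCast]
    rw [one_div] at h1
    have := (Real.le_rpow_inv_iff_of_pos (norm_nonneg _) hpos (by positivity)).1 h1
    rwa [Real.rpow_natCast] at this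
  filter_upwards [ball_mem_nhds 0 hR] with z hz
  -- Replacing z by t·z multiplies the left side by t^(jb) and the right side by at most t^(ak). As
  -- jb + 1 ≤ ak, a factor t is left over, and t → 0 finishes.
  have hscale : ∀ t : ℝ, 0 < t → t ≤ 1 →
      ‖weightComponent m j h z‖ ^ b ≤ C * ‖z‖ ^ k * t := by
    intro t ht0 ht1
    have htn : ‖(t : ℂ)‖ = t := by simp [abs_of_pos ht0]
    have htn1 : ‖(t : ℂ)‖ ≤ 1 := htn.trans_le ht1
    have h1 := hbound _ (weightedScale_mem_ball (m := m) hz htn1)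
    rw [(hqw.mono hsub).apply_weightedScale (hqd.mono hsub) hz htn1, norm_mul, norm_pow, htn] at h1
    have h2 := norm_weightedScale_le htn1 ha z
    rw [htn] at h2
    have h3 : t ^ (j * b) * ‖weightComponent m j h z‖ ^ b ≤ t ^ (j * b) * (C * ‖z‖ ^ k * t) := by
      calc _ = (t ^ j * ‖weightComponent m j h z‖) ^ b := by rw [mul_pow, pow_mul]
        _ ≤ C * (t ^ a * ‖z‖) ^ k := h1.trans (by gcongr)
        _ = C * ‖z‖ ^ k * t ^ (a * k) := by rw [mul_pow, pow_mul]; ring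
        _ ≤ C * ‖z‖ ^ k * t ^ (j * b + 1) :=
          mul_le_mul_of_nonneg_left (pow_le_pow_of_le_one ht0.le ht1 hlt) (by positivity)
        _ = _ := by ring
    exact le_of_mul_le_mul_left h3 (by positivity)
  have hlim : Tendsto (fun t : ℝ => C * ‖z‖ ^ k * t) (𝓝[>] 0) (𝓝 0) := by
    have : Tendsto (fun t : ℝ => C * ‖z‖ ^ k * t) (𝓝 0) (𝓝 (C * ‖z‖ ^ k * 0)) :=
      tendsto_id.const_mul _
    rw [mul_zero] at this
    exact this.mono_left nhdsWithin_le_nhds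
  have hle : ‖weightComponent m j h z‖ ^ b ≤ 0 := by
    refine ge_of_tendsto hlim ?_
    filter_upwards [Ioc_mem_nhdsGT (zero_lt_one' ℝ)] with t ht using hscale t ht.1 ht.2
  have : ‖weightComponent m j h z‖ ^ b = 0 := le_antisymm hle (by positivity)
  exact norm_eq_zero.1 (pow_eq_zero_iff hb.ne' |>.1 this)

end Component

/-! ### Orthogonality of distinct weights in `L²`. -/

section Averaging

variable {n : ℕ} {m : Fin n → ℕ} {D : Set (Fin n → ℂ)}

theorem measurePreserving_weightedCircleAction (t : Circle) :
    MeasurePreserving (weightedCircleAction m t) := by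
  have h1 : ∀ i, MeasurePreserving (fun z : ℂ => (t : ℂ) ^ m i * z) := fun i => by
    have h2 : (fun z : ℂ => (t : ℂ) ^ m i * z) = rotation (t ^ m i) := by
      funext z
      rw [rotation_apply, Circle.coe_pow]
    rw [h2]
    exact (rotation (t ^ m i)).measurePreserving
  exact volume_preserving_pi h1

theorem IsBoundedQuasiCircularDomain.preimage_eq (hD : IsBoundedQuasiCircularDomain m D)
    (t : Circle) : weightedCircleAction m t ⁻¹' D = D := by
  refine Subset.antisymm (fun z hz => ?_) (fun z hz => hD.invariant t z hz)
  have := hD.invariant t⁻¹ _ hz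
  rwa [weightedCircleAction_mul, inv_mul_cancel, weightedCircleAction_one] at this

theorem IsBoundedQuasiCircularDomain.measurePreserving (hD : IsBoundedQuasiCircularDomain m D)
    (t : Circle) : MeasurePreserving (weightedCircleAction m t) (volume.restrict D)
      (volume.restrict D) := by
  have := (measurePreserving_weightedCircleAction (m := m) t).restrict_preimage
    hD.isOpen.measurableSet
  rwa [hD.preimage_eq] at this

/-- Integrating against the conjugate of a function of weight `k` only sees the component of
weight `k`. -/
theorem setIntegral_mul_conj_eq_weightComponent (hD : IsBoundedQuasiCircularDomain m D)
    {q u : (Fin n → ℂ) → ℂ} (hqc : ContinuousOn q D) (hqi : IntegrableOn q D)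
    (huc : ContinuousOn u D) {B : ℝ} (hB : ∀ z ∈ D, ‖u z‖ ≤ B) {k : ℤ}
    (hu : HasWeightOn m k u D) :
    ∫ z in D, q z * conj (u z) = ∫ z in D, weightComponent m k q z * conj (u z) := by
  have hDm := hD.isOpen.measurableSet
  have hconj : ContinuousOn (fun z => conj (u z)) D := Complex.continuous_conj.comp_continuousOn huc
  have hint : IntegrableOn (fun z => q z * conj (u z)) D :=
    hqi.mul_bdd (c := B) (hconj.aestronglyMeasurable hDm)
      (by filter_upwards [ae_restrict_mem hDm] with z hz; simpa using hB z hz)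
  -- The Fourier character is absorbed by the weight of u, so `G x` is the original integrand moved
  -- by the action. Its integral over D is therefore independent of x, and Fubini averages q into
  -- its component.
  set G : UnitAddCircle → (Fin n → ℂ) → ℂ := fun x z =>
    (fourier (-k) x • q (weightedCircleAction m x.toCircle z)) * conj (u z) with hG
  have hGeq : ∀ x : UnitAddCircle, ∀ z ∈ D, G x z =
      q (weightedCircleAction m x.toCircle z) * conj (u (weightedCircleAction m x.toCircle z)) := by
    intro x z hz
    have h1 : (fourier (-k) x : ℂ) = conj ((x.toCircle : ℂ) ^ k) := by
      rw [fourier_neg, fourier_apply, AddCircle.toCircle_zsmul, Circle.coe_zpow]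
    rw [hu _ z hz, map_mul, ← h1]
    simp only [hG, smul_eq_mul]
    ring
  have hGint : ∀ x, Integrable (G x) (volume.restrict D) := by
    intro x
    refine (((hD.measurePreserving x.toCircle).integrable_comp hint.aestronglyMeasurable).2
      hint).congr ?_
    filter_upwards [ae_restrict_mem hDm] with z hz using (hGeq x z hz).symm
  have hGval : ∀ x, ∫ z in D, G x z = ∫ z in D, q z * conj (u z) := by
    intro x
    have hmp := hD.measurePreserving x.toCircle
    rw [setIntegral_congr_fun hDm (hGeq x)]
    conv_rhs => rw [← hmp.map_eq]
    rw [integral_map hmp.aemeasurable (by rw [hmp.map_eq]; exact hint.aestronglyMeasurable)]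
  have hGnorm : ∀ x, ∫ z in D, ‖G x z‖ = ∫ z in D, ‖q z * conj (u z)‖ := by
    intro x
    have hmp := hD.measurePreserving x.toCircle
    rw [setIntegral_congr_fun hDm (fun z hz => congrArg norm (hGeq x z hz))]
    conv_rhs => rw [← hmp.map_eq]
    rw [integral_map hmp.aemeasurable (by rw [hmp.map_eq]; exact hint.aestronglyMeasurable.norm)]
  have hGmeas : AEStronglyMeasurable (Function.uncurry G)
      ((AddCircle.haarAddCircle (T := 1)).prod (volume.restrict D)) := by
    rw [← Measure.restrict_univ (μ := AddCircle.haarAddCircle (T := 1)), Measure.prod_restrict]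
    refine ContinuousOn.aestronglyMeasurable ?_ (MeasurableSet.univ.prod hDm)
    have h1 := (continuousOn_comp_weightedCircleAction hD hqc).comp
      (f := fun p : UnitAddCircle × (Fin n → ℂ) => (p.2, p.1)) (s := univ ×ˢ D)
      (by fun_prop) fun p hp => ⟨hp.2, hp.1⟩
    have h2 : Continuous fun p : UnitAddCircle × (Fin n → ℂ) => (fourier (-k) p.1 : ℂ) :=
      (map_continuous (fourier (-k))).comp continuous_fst
    exact (h2.continuousOn.smul h1).mul (hconj.comp continuousOn_snd fun p hp => hp.2)
  have hGprod : Integrable (Function.uncurry G)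
      ((AddCircle.haarAddCircle (T := 1)).prod (volume.restrict D)) := by
    refine (integrable_prod_iff hGmeas).2 ⟨Eventually.of_forall hGint, ?_⟩
    simp only [Function.uncurry_apply_pair, hGnorm]
    exact integrable_const _
  calc ∫ z in D, q z * conj (u z)
      = ∫ x, ∫ z in D, G x z ∂volume ∂(AddCircle.haarAddCircle (T := 1)) := by
        simp [hGval]
    _ = ∫ z in D, ∫ x, G x z ∂(AddCircle.haarAddCircle (T := 1)) := integral_integral_swap hGprod
    _ = ∫ z in D, weightComponent m k q z * conj (u z) := by
        simp only [hG, integral_mul_const, weightComponent, fourierCoeff]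

end Averaging

/-! ### Change of variables under a biholomorphism. -/

section ChangeOfVariables

variable {n : ℕ} {D D' : Set (Fin n → ℂ)} {f g : (Fin n → ℂ) → (Fin n → ℂ)}

theorem abs_det_restrictScalars (A : (Fin n → ℂ) →L[ℂ] (Fin n → ℂ)) :
    |(A.restrictScalars ℝ).det| = ‖A.det‖ ^ 2 := by
  have : (A.restrictScalars ℝ).det = ‖A.det‖ ^ 2 := by
    rw [ContinuousLinearMap.det, ContinuousLinearMap.det, ← Complex.normSq_eq_norm_sq]
    have := LinearMap.det_restrictScalars (R := ℝ) (f := (A : (Fin n → ℂ) →ₗ[ℂ] (Fin n → ℂ)))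
    rw [Algebra.norm_complex_eq] at this
    exact this
  rw [this, abs_of_nonneg (by positivity)]

theorem jacobianDet_mul_eq_one (hD : IsOpen D) (hD' : IsOpen D') (hf : DifferentiableOn ℂ f D)
    (hfm : MapsTo f D D') (hg : DifferentiableOn ℂ g D') (hl : LeftInvOn g f D)
    {z : Fin n → ℂ} (hz : z ∈ D) : jacobianDet g (f z) * jacobianDet f z = 1 := by
  have h1 := ((hf z hz).differentiableAt (hD.mem_nhds hz)).hasFDerivAt
  have h2 := ((hg _ (hfm hz)).differentiableAt (hD'.mem_nhds (hfm hz))).hasFDerivAt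
  have h3 : HasFDerivAt (g ∘ f) (ContinuousLinearMap.id ℂ (Fin n → ℂ)) z := by
    refine (hasFDerivAt_id z).congr_of_eventuallyEq ?_
    filter_upwards [hD.mem_nhds hz] with w hw using hl hw
  have h4 := congrArg ContinuousLinearMap.det ((h2.comp z h1).unique h3)
  simp only [ContinuousLinearMap.det, ContinuousLinearMap.coe_id, LinearMap.det_id] at h4
  rw [← h4]
  exact (LinearMap.det_comp _ _).symm

theorem hasFDerivWithinAt_restrictScalars (hD : IsOpen D) (hf : DifferentiableOn ℂ f D) :
    ∀ z ∈ D, HasFDerivWithinAt f ((fderiv ℂ f z).restrictScalars ℝ) D z := fun z hz =>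
  (((hf z hz).differentiableAt (hD.mem_nhds hz)).hasFDerivAt.restrictScalars ℝ).hasFDerivWithinAt

theorem image_eq_of_leftInvOn_of_rightInvOn (hfm : MapsTo f D D') (hgm : MapsTo g D' D)
    (hr : RightInvOn g f D') : f '' D = D' :=
  Subset.antisymm hfm.image_subset fun w hw => ⟨g w, hgm hw, hr hw⟩

theorem integrableOn_comp_mul_jacobianDet (hD : IsOpen D) (hDb : Bornology.IsBounded D)
    (hDb' : Bornology.IsBounded D')
    (hf : DifferentiableOn ℂ f D) (hfm : MapsTo f D D') (hgm : MapsTo g D' D)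
    (hi : InvOn g f D D') {h : (Fin n → ℂ) → ℂ} (hc : ContinuousOn h D') {B : ℝ}
    (hB : ∀ w ∈ D', ‖h w‖ ≤ B) : IntegrableOn (fun z => h (f z) * jacobianDet f z) D := by
  have hJ := differentiableOn_jacobianDet hD hf
  -- The volume of D' is the integral of |J_f|² over D, so J_f is square-integrable; ‖J‖ ≤ 1 + ‖J‖²
  -- then gives integrability on the bounded set D.
  have h1 : IntegrableOn (fun _ => (1 : ℝ)) D' := by
    simpa using hDb'.measure_lt_top
  rw [← image_eq_of_leftInvOn_of_rightInvOn hfm hgm hi.2,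
    integrableOn_image_iff_integrableOn_abs_det_fderiv_smul volume hD.measurableSet
      (hasFDerivWithinAt_restrictScalars hD hf) hi.1.injOn] at h1
  simp only [abs_det_restrictScalars, smul_eq_mul, mul_one] at h1
  have h2 : IntegrableOn (fun _ => (1 : ℝ)) D := by
    simpa using hDb.measure_lt_top
  refine ((h2.add h1).const_mul B).mono'
    (((hc.comp hf.continuousOn hfm).mul hJ.continuousOn).aestronglyMeasurable hD.measurableSet) ?_
  filter_upwards [ae_restrict_mem hD.measurableSet] with z hz
  have h3 : ‖jacobianDet f z‖ ≤ 1 + ‖jacobianDet f z‖ ^ 2 := by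
    nlinarith [sq_nonneg (‖jacobianDet f z‖ - 1), norm_nonneg (jacobianDet f z)]
  rw [norm_mul]
  exact mul_le_mul (hB _ (hfm hz)) h3 (norm_nonneg _) ((norm_nonneg _).trans (hB _ (hfm hz)))

/-- The pull-back of holomorphic functions, twisted by the Jacobian, is unitary. -/
theorem setIntegral_comp_mul_jacobianDet_mul_conj (hD : IsOpen D) (hD' : IsOpen D')
    (hf : DifferentiableOn ℂ f D) (hfm : MapsTo f D D') (hg : DifferentiableOn ℂ g D')
    (hgm : MapsTo g D' D) (hi : InvOn g f D D') (h u : (Fin n → ℂ) → ℂ) :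
    ∫ z in D, h (f z) * jacobianDet f z * conj (u z) =
      ∫ w in D', h w * conj (u (g w) * jacobianDet g w) := by
  conv_rhs => rw [← image_eq_of_leftInvOn_of_rightInvOn hfm hgm hi.2]
  rw [integral_image_eq_integral_abs_det_fderiv_smul volume hD.measurableSet
      (hasFDerivWithinAt_restrictScalars hD hf) hi.1.injOn]
  refine setIntegral_congr_fun hD.measurableSet fun z hz => ?_
  have h1 := congrArg conj (jacobianDet_mul_eq_one hD hD' hf hfm hg hi.1 hz)
  rw [map_mul, map_one] at h1
  have h2 : ((‖jacobianDet f z‖ ^ 2 : ℝ) : ℂ) = jacobianDet f z * conj (jacobianDet f z) := by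
    rw [Complex.mul_conj, Complex.normSq_eq_norm_sq]
  simp only [abs_det_restrictScalars, hi.1 hz, map_mul]
  change _ = ‖jacobianDet f z‖ ^ 2 • _
  rw [Complex.real_smul, h2]
  linear_combination (-(h (f z) * jacobianDet f z * conj (u z))) * h1

end ChangeOfVariables

/-! ### Polynomiality of the twisted pull-back and of f. -/

section Main

variable {n : ℕ} {m m' : Fin n → ℕ} {D D' : Set (Fin n → ℂ)} {f g : (Fin n → ℂ) → (Fin n → ℂ)}

/-- The order of vanishing of u at 0 survives composition because g(0) = 0 and g is differentiable
there, so ‖g w‖ = O(‖w‖); the Jacobian factor is locally bounded. -/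
theorem exists_norm_comp_mul_jacobianDet_pow_le (hD' : IsBoundedQuasiCircularDomain m' D')
    (hD : IsBoundedQuasiCircularDomain m D) (hg : DifferentiableOn ℂ g D') (hg0 : g 0 = 0)
    {u : (Fin n → ℂ) → ℂ} (hu : DifferentiableOn ℂ u D) {k : ℕ} (huw : HasWeightOn m k u D)
    {b : ℕ} (hb0 : 0 < b) (hb : ∀ i, m i ≤ b) :
    ∃ C ≥ 0, ∀ᶠ w in 𝓝 (0 : Fin n → ℂ), ‖u (g w) * jacobianDet g w‖ ^ b ≤ C * ‖w‖ ^ k := by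
  obtain ⟨C, hC, hCu⟩ := huw.exists_norm_pow_le hD hu hb0 hb
  have h0 := hD'.isOpen.mem_nhds hD'.zero_mem
  have hgd := (hg 0 hD'.zero_mem).differentiableAt h0
  have hgt : Tendsto g (𝓝 0) (𝓝 0) := by
    simpa [ContinuousAt, hg0] using hgd.continuousAt
  obtain ⟨L, hL, hLg⟩ := hgd.isBigO_sub.exists_nonneg
  have hJ := (differentiableOn_jacobianDet hD'.isOpen hg).continuousOn.continuousAt h0
  have hJb : ∀ᶠ w in 𝓝 (0 : Fin n → ℂ), ‖jacobianDet g w‖ < ‖jacobianDet g 0‖ + 1 :=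
    hJ.norm.eventually_lt_const (lt_add_one _)
  refine ⟨C * L ^ k * (‖jacobianDet g 0‖ + 1) ^ b, by positivity, ?_⟩
  filter_upwards [hgt.eventually hCu, hLg.bound, hJb] with w h1 h2 h3
  simp only [hg0, sub_zero] at h2
  calc ‖u (g w) * jacobianDet g w‖ ^ b = ‖u (g w)‖ ^ b * ‖jacobianDet g w‖ ^ b := by
        rw [norm_mul, mul_pow]
    _ ≤ (C * (L * ‖w‖) ^ k) * (‖jacobianDet g 0‖ + 1) ^ b := by
        gcongr
        exact h1.trans (by gcongr)
    _ = _ := by rw [mul_pow]; ring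

theorem IsBoundedQuasiCircularDomain.exists_bound_of_mvPolynomial
    (hD : IsBoundedQuasiCircularDomain m D) (P : MvPolynomial (Fin n) ℂ) :
    ∃ B, ∀ z ∈ D, ‖MvPolynomial.eval z P‖ ≤ B := by
  obtain ⟨B, hB⟩ := hD.isBounded.isCompact_closure.exists_bound_of_continuousOn
    (MvPolynomial.continuous_eval P).continuousOn
  exact ⟨B, fun z hz => hB z (subset_closure hz)⟩

theorem eqOn_zero_of_setIntegral_mul_conj_eq_zero (hDo : IsOpen D) (hDb : Bornology.IsBounded D)
    {u : (Fin n → ℂ) → ℂ} (hu : ContinuousOn u D) {B : ℝ} (hB : ∀ z ∈ D, ‖u z‖ ≤ B)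
    (h : ∫ z in D, u z * conj (u z) = 0) : ∀ z ∈ D, u z = 0 := by
  have hint : IntegrableOn (fun z => ‖u z‖ ^ 2) D := by
    refine IntegrableOn.of_bound hDb.measure_lt_top
      ((hu.norm.pow 2).aestronglyMeasurable hDo.measurableSet) (B ^ 2) ?_
    filter_upwards [ae_restrict_mem hDo.measurableSet] with z hz
    rw [norm_pow, norm_norm]
    exact pow_le_pow_left₀ (norm_nonneg _) (hB z hz) 2
  have h1 : ∫ z in D, ‖u z‖ ^ 2 = 0 := by
    have h2 : ∀ z, u z * conj (u z) = ((‖u z‖ ^ 2 : ℝ) : ℂ) := fun z => by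
      rw [Complex.mul_conj, Complex.normSq_eq_norm_sq]
    simp only [h2] at h
    rw [integral_complex_ofReal] at h
    exact_mod_cast h
  have h2 := (setIntegral_eq_zero_iff_of_nonneg_ae
    (Eventually.of_forall fun z => by positivity) hint).1 h1
  have h3 := Measure.eqOn_open_of_ae_eq h2 hDo (hu.norm.pow 2) continuousOn_const
  intro z hz
  simpa using h3 hz

/-- The weight components of the twisted pull-back of a function of weight `j` vanish outside a
bounded range of weights. -/
theorem weightComponent_comp_mul_jacobianDet_eq_zero
    (hD : IsBoundedQuasiCircularDomain m D) (hD' : IsBoundedQuasiCircularDomain m' D')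
    (hf : DifferentiableOn ℂ f D) (hfm : MapsTo f D D') (hg : DifferentiableOn ℂ g D')
    (hgm : MapsTo g D' D) (hi : InvOn g f D D') (hg0 : g 0 = 0)
    {a a' b : ℕ} (ha0 : 0 < a) (ha : ∀ i, a ≤ m i) (ha' : ∀ i, a' ≤ m' i) (hb0 : 0 < b)
    (hb : ∀ i, m i ≤ b) {h : (Fin n → ℂ) → ℂ} (hd : DifferentiableOn ℂ h D') {B : ℝ}
    (hB : ∀ w ∈ D', ‖h w‖ ≤ B) {j k : ℕ} (hw : HasWeightOn m' j h D') (hlt : j * b < a' * k) :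
    ∀ z ∈ D, weightComponent m k (fun z => h (f z) * jacobianDet f z) z = 0 := by
  set p : (Fin n → ℂ) → ℂ := fun z => h (f z) * jacobianDet f z with hp
  set u := weightComponent m k p with hu
  have hpd : DifferentiableOn ℂ p D :=
    (hd.comp hf hfm).mul (differentiableOn_jacobianDet hD.isOpen hf)
  have hud : DifferentiableOn ℂ u D := differentiableOn_weightComponent hD hpd k
  have huw : HasWeightOn m k u D := hasWeightOn_weightComponent k D
  -- Polynomiality serves here only to bound u on the bounded set D.
  obtain ⟨P, hP, -⟩ := huw.exists_mvPolynomial hD ha0 ha k hud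
  obtain ⟨Bu, hBu⟩ : ∃ Bu, ∀ z ∈ D, ‖u z‖ ≤ Bu := by
    obtain ⟨Bu, hBu⟩ := hD.exists_bound_of_mvPolynomial P
    exact ⟨Bu, fun z hz => hP z hz ▸ hBu z hz⟩
  set q : (Fin n → ℂ) → ℂ := fun w => u (g w) * jacobianDet g w with hq
  have hqd : DifferentiableOn ℂ q D' :=
    (hud.comp hg hgm).mul (differentiableOn_jacobianDet hD'.isOpen hg)
  have hpi : IntegrableOn p D := integrableOn_comp_mul_jacobianDet hD.isOpen hD.isBounded
    hD'.isBounded hf hfm hgm hi hd.continuousOn hB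
  have hqi : IntegrableOn q D' := integrableOn_comp_mul_jacobianDet hD'.isOpen hD'.isBounded
    hD.isBounded hg hgm hfm hi.symm hud.continuousOn hBu
  obtain ⟨C, hC, hCq⟩ := exists_norm_comp_mul_jacobianDet_pow_le hD' hD hg hg0 hud huw hb0 hb
  have hq0 := weightComponent_eq_zero_of_norm_pow_le hD' hqd ha' hb0 hC hCq hlt
  -- Only the weight-j component of q pairs with h, and it vanishes by the order of q at 0.
  have h1 : ∫ w in D', q w * conj (h w) = 0 := by
    rw [setIntegral_mul_conj_eq_weightComponent hD' hqd.continuousOn hqi hd.continuousOn hB hw]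
    refine setIntegral_eq_zero_of_forall_eq_zero fun w hwD => ?_
    rw [hq0 w hwD, zero_mul]
  have h2 : ∫ w in D', h w * conj (q w) = 0 := by
    have h3 : ∀ w, h w * conj (q w) = conj (q w * conj (h w)) := fun w => by
      rw [map_mul _ (q w), Complex.conj_conj, mul_comm]
    simp only [h3]
    rw [integral_conj, h1, map_zero]
  -- ⟨u, u⟩ = ⟨p, u⟩ since u is the weight-k component of p, and ⟨p, u⟩ = ⟨h, q⟩ = 0.
  refine eqOn_zero_of_setIntegral_mul_conj_eq_zero hD.isOpen hD.isBounded hud.continuousOn hBu ?_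
  rw [hu, ← setIntegral_mul_conj_eq_weightComponent hD hpd.continuousOn hpi hud.continuousOn hBu
    huw, ← h2]
  exact setIntegral_comp_mul_jacobianDet_mul_conj hD.isOpen hD'.isOpen hf hfm hg hgm hi h u

/-- The twisted pull-back of a bounded function of weight `j` is a polynomial. -/
theorem exists_mvPolynomial_comp_mul_jacobianDet
    (hD : IsBoundedQuasiCircularDomain m D) (hD' : IsBoundedQuasiCircularDomain m' D')
    (hf : DifferentiableOn ℂ f D) (hfm : MapsTo f D D') (hg : DifferentiableOn ℂ g D')
    (hgm : MapsTo g D' D) (hi : InvOn g f D D') (hg0 : g 0 = 0)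
    {a a' b : ℕ} (ha0 : 0 < a) (ha : ∀ i, a ≤ m i) (ha0' : 0 < a') (ha' : ∀ i, a' ≤ m' i)
    (hb0 : 0 < b) (hb : ∀ i, m i ≤ b) {h : (Fin n → ℂ) → ℂ} (hd : DifferentiableOn ℂ h D') {B : ℝ}
    (hB : ∀ w ∈ D', ‖h w‖ ≤ B) {j : ℕ} (hw : HasWeightOn m' j h D') :
    ∃ P : MvPolynomial (Fin n) ℂ, (∀ z ∈ D, h (f z) * jacobianDet f z = MvPolynomial.eval z P) ∧
      P.totalDegree * (a * a') ≤ j * b := by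
  set p : (Fin n → ℂ) → ℂ := fun z => h (f z) * jacobianDet f z with hp
  have hpd : DifferentiableOn ℂ p D :=
    (hd.comp hf hfm).mul (differentiableOn_jacobianDet hD.isOpen hf)
  have hcd := fun k => differentiableOn_weightComponent hD hpd k
  have hcw := fun k => hasWeightOn_weightComponent (m := m) (h := p) k D
  choose Q hQ hQd using fun k : ℕ => (hcw k).exists_mvPolynomial hD ha0 ha k (hcd k)
  -- The floor of jb/a': weights k > N satisfy jb < a'k, so their components vanish.
  set N := j * b / a' with hN
  refine ⟨∑ k ∈ Finset.range (N + 1), Q k, fun z hz => ?_, ?_⟩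
  · have h1 := eq_sum_weightComponent hD hpd.continuousOn hz
      ((Finset.range (N + 1)).map Nat.castEmbedding) (fun k hk => by
        rcases lt_or_ge k 0 with hk0 | hk0
        · exact (hcw k).eqOn_zero_of_neg hD (hcd k) hk0 z hz
        · lift k to ℕ using hk0
          refine weightComponent_comp_mul_jacobianDet_eq_zero hD hD' hf hfm hg hgm hi hg0 ha0 ha
            ha' hb0 hb hd hB hw ?_ z hz
          have hNk : N < k := by
            by_contra hle
            exact hk (Finset.mem_map.2 ⟨k, Finset.mem_range.2 (by omega), rfl⟩)
          rw [mul_comm a']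
          exact (Nat.div_lt_iff_lt_mul ha0').1 hNk)
    rw [Finset.sum_map] at h1
    change p z = _
    rw [h1, map_sum]
    exact Finset.sum_congr rfl fun k _ => hQ k z hz
  · rw [← Nat.le_div_iff_mul_le (by positivity)]
    refine MvPolynomial.totalDegree_finsetSum_le fun k hk => ?_
    rw [Nat.le_div_iff_mul_le (by positivity), ← mul_assoc]
    have hkN : k ≤ N := Nat.lt_succ_iff.1 (Finset.mem_range.1 hk)
    calc _ ≤ k * a' := Nat.mul_le_mul_right _ (hQd k)
      _ ≤ N * a' := Nat.mul_le_mul_right _ hkN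
      _ ≤ j * b := Nat.div_mul_le_self _ _

/-- A biholomorphism of bounded quasi-circular domains fixing the origin is polynomial, with an
explicit bound on the degree of each component. -/
theorem exists_mvPolynomial_of_biholomorphism
    (hD : IsBoundedQuasiCircularDomain m D) (hD' : IsBoundedQuasiCircularDomain m' D')
    (hf : DifferentiableOn ℂ f D) (hfm : MapsTo f D D') (hg : DifferentiableOn ℂ g D')
    (hgm : MapsTo g D' D) (hi : InvOn g f D D') (hg0 : g 0 = 0)
    {a a' b : ℕ} (ha0 : 0 < a) (ha : ∀ i, a ≤ m i) (ha0' : 0 < a') (ha' : ∀ i, a' ≤ m' i)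
    (hb0 : 0 < b) (hb : ∀ i, m i ≤ b) (i : Fin n) :
    ∃ P : MvPolynomial (Fin n) ℂ, (∀ z ∈ D, f z i = MvPolynomial.eval z P) ∧
      P.totalDegree * (a * a') ≤ m' i * b := by
  -- h = 1 has weight 0, so its twisted pull-back, the Jacobian determinant of f, is constant.
  obtain ⟨P₀, hP₀, hP₀d⟩ := exists_mvPolynomial_comp_mul_jacobianDet hD hD' hf hfm hg hgm hi hg0
    ha0 ha ha0' ha' hb0 hb (h := fun _ => 1) (differentiableOn_const 1) (B := 1) (by simp) (j := 0)
    (fun t w _ => by simp)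
  have hdeg : P₀.totalDegree = 0 := by
    have h1 : P₀.totalDegree * (a * a') = 0 := by omega
    exact (mul_eq_zero.1 h1).resolve_right (by positivity)
  obtain ⟨c, hc⟩ : ∃ c, P₀ = MvPolynomial.C c :=
    ⟨_, MvPolynomial.totalDegree_eq_zero_iff_eq_C.1 hdeg⟩
  have hJ : ∀ z ∈ D, jacobianDet f z = c := fun z hz => by
    simpa [hc] using hP₀ z hz
  have hc0 : c ≠ 0 := by
    have h1 := jacobianDet_mul_eq_one hD.isOpen hD'.isOpen hf hfm hg hi.1 hD.zero_mem
    rw [hJ 0 hD.zero_mem] at h1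
    exact right_ne_zero_of_mul_eq_one h1
  obtain ⟨B, hB⟩ := hD'.isBounded.exists_norm_le
  -- The coordinate w_i has weight m' i and is bounded on D'; its twisted pull-back is c · f_i.
  obtain ⟨P, hP, hPd⟩ := exists_mvPolynomial_comp_mul_jacobianDet hD hD' hf hfm hg hgm hi hg0
    ha0 ha ha0' ha' hb0 hb (h := fun w => w i) (differentiable_apply i).differentiableOn (B := B)
    (fun w hw => (norm_le_pi_norm w i).trans (hB w hw)) (j := m' i)
    (fun t w _ => by simp [weightedCircleAction])
  refine ⟨MvPolynomial.C c⁻¹ * P, fun z hz => ?_, ?_⟩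
  · have h1 := hP z hz
    rw [hJ z hz] at h1
    rw [map_mul, MvPolynomial.eval_C, ← h1]
    field_simp
  · have h1 : (MvPolynomial.C c⁻¹ * P).totalDegree ≤ P.totalDegree := by
      simpa using MvPolynomial.totalDegree_mul (MvPolynomial.C c⁻¹) P
    exact (Nat.mul_le_mul_right _ h1).trans hPd

end Main

theorem corollary6p1 (n : ℕ) (hn : 0 < n) (m m' : Fin n → ℕ)
    (hm_pos : ∀ i, 0 < m i) (hm_mono : Monotone m)
    (hm'_pos : ∀ i, 0 < m' i) (hm'_mono : Monotone m')
    (D D' : Set (Fin n → ℂ))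
    (hD : IsBoundedQuasiCircularDomain m D) (hD' : IsBoundedQuasiCircularDomain m' D')
    (f : (Fin n → ℂ) → (Fin n → ℂ))
    (hf : IsBiholomorphismOn f D D') (hf0 : f 0 = 0) :
    ∃ P : Fin n → MvPolynomial (Fin n) ℂ,
      (∀ z ∈ D, ∀ i, f z i = MvPolynomial.eval z (P i)) ∧
      ∀ i, ((P i).totalDegree : ℝ) ≤
        ((m ⟨n - 1, by omega⟩ : ℝ) * (m' ⟨n - 1, by omega⟩ : ℝ)) /
          ((m ⟨0, hn⟩ : ℝ) * (m' ⟨0, hn⟩ : ℝ)) := by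
  obtain ⟨hfd, hfm, g, hg, hgm, hi⟩ := hf
  have hg0 : g 0 = 0 := by
    have := hi.1 hD.zero_mem
    rwa [hf0] at this
  have hlast : ∀ i : Fin n, i ≤ ⟨n - 1, by omega⟩ := fun i => by
    rw [Fin.le_def]
    have := i.isLt
    show (i : ℕ) ≤ n - 1
    omega
  have hfirst : ∀ i : Fin n, (⟨0, hn⟩ : Fin n) ≤ i := fun i => by
    rw [Fin.le_def]
    exact Nat.zero_le _
  -- By monotonicity the extreme weights serve as a = m_1, a' = m'_1 and b = m_n.
  choose P hP hPd using exists_mvPolynomial_of_biholomorphism hD hD' hfd hfm hg hgm hi hg0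
    (hm_pos ⟨0, hn⟩) (fun i => hm_mono (hfirst i)) (hm'_pos ⟨0, hn⟩)
    (fun i => hm'_mono (hfirst i)) (hm_pos ⟨n - 1, by omega⟩) (fun i => hm_mono (hlast i))
  refine ⟨P, fun z hz i => hP i z hz, fun i => ?_⟩
  have h1 := hm_pos ⟨0, hn⟩
  have h2 := hm'_pos ⟨0, hn⟩
  rw [le_div_iff₀ (by positivity)]
  have h3 := (hPd i).trans (Nat.mul_le_mul_right _ (hm'_mono (hlast i)))
  rw [mul_comm (m' _) (m _)] at h3
  exact_mod_cast h3
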